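/- Let $K$ be a field with $\operatorname{char} K\neq 2$ and let $X$ be a connected poset (any $x,y\in X$ are joined by a finite sequence in $X$ whose consecutive terms are comparable). Let $FI(X,K)$ be the finitary incidence algebra of $X$ over $K$: the $K$-space of functions $f:X\times X\to K$ such that $f(x,y)=0$ whenever $x\not\leq y$ and such that, for all $x\leq y$, only finitely many subintervals $[u,v]\subseteq[x,y]$ satisfy $u\neq v$ and $f(u,v)\neq 0$, with the product $(fg)(x,y)=\sum_{x\leq z\leq y}f(x,z)g(z,y)$. For an invertible $u\in FI(X,K)$, let $\Psi_u$ denote the inner automorphism $a\mapsto uau^{-1}$. Assume that every multiplicative automorphism of $FI(X,K)$ is inner, i.e. for every $\sigma:X\times X\to K$ that vanishes at $(x,y)$ whenever $x\nleq y$ and satisfies $\sigma(x,y)\neq 0$ for $x\leq y$ and $\sigma(x,y)\sigma(y,z)=\sigma(x,z)$ for $x\leq y\leq z$, the automorphism $M_\sigma$ given by $M_\sigma(f)(x,y)=\sigma(x,y)f(x,y)$ equals $\Psi_u$ for some invertible $u\in FI(X,K)$. An involution on $FI(X,K)$ is an additive (not necessarily $K$-linear) map $\rho:FI(X,K)\to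 FI(X,K)$ with $\rho(ab)=\rho(b)\rho(a)$ and $\rho(\rho(a))=a$ for all $a,b$ (it is of the first kind if it is the identity on the center, and of the second kind otherwise). An involution on $X$ is a map $\lambda:X\to X$ with $\lambda(\lambda(x))=x$, and $x\leq y\Leftrightarrow\lambda(y)\leq\lambda(x)$, for all $x,y\in X$. For $x\in X$ let $e_x\in FI(X,K)$ be the function equal to $1$ at $(x,x)$ and to $0$ elsewhere. We say that $\rho$ induces $\lambda$ on $X$ if, for each $x\in X$, $\lambda(x)$ is the unique $y\in X$ such that $\rho(e_x)=fe_yf^{-1}$ for some invertible $f\in FI(X,K)$. **Theorem.** Let $\rho_1$ and $\rho_2$ be involutions (each of the first or second kind) on $FI(X,K)$. If there exists an invertible $u\in FI(X,K)$ such that $\Psi_u\circ\rho_2=\rho_1\circ\Psi_u$, then $\rho_1$ and $\rho_2$ induce the same involution on $X$ (that is, there is an involution $\lambda$ on $X$ which is induced both by $\rho_1$ and by $\rho_2$), and $\rho_1|_K=\rho_2|_K$, where $K$ is identified with the scalar multiples of the identity of $FI(X,K)$. -/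

import Mathlib

/-! ### Involutions and inner automorphisms of an algebra -/

/-- An involution on a ring (in particular, on an algebra): an additive, multiplication-reversing
map of order at most two. It is *not* required to be linear, so that involutions of the first kind
(the identity on the center) and of the second kind are both covered. -/
structure IsAlgInvolution {A : Type*} [Ring A] (ρ : A → A) : Prop where
  map_add : ∀ a b, ρ (a + b) = ρ a + ρ b
  map_mul_rev : ∀ a b, ρ (a * b) = ρ b * ρ a
  involutive : ∀ a, ρ (ρ a) = a

/-- The inner automorphism `Ψ_u : a ↦ u a u⁻¹` of the `K`-algebra `A`. -/
def innerAut (K : Type*) {A : Type*} [CommSemiring K] [Ring A] [Algebra K A] (u : Aˣ) :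
    A ≃ₐ[K] A where
  toFun a := u * a * (u⁻¹ : Aˣ)
  invFun a := (u⁻¹ : Aˣ) * a * u
  left_inv a := by simp [mul_assoc]
  right_inv a := by simp [mul_assoc]
  map_mul' a b := by simp [mul_assoc]
  map_add' a b := by simp [mul_add, add_mul]
  commutes' k := by
    rw [← Algebra.commutes k (u : A), mul_assoc, Units.mul_inv, mul_one]

/-! ### Posets -/

/-- `λ : X → X` is an involution of the poset `X`: it has order at most two and reverses the
order. -/
structure IsPosetInvolution {X : Type*} [PartialOrder X] (l : X → X) : Prop where
  involutive : ∀ x, l (l x) = x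
  le_iff : ∀ x y, x ≤ y ↔ l y ≤ l x

/-- A poset is connected if any two elements are joined by a finite sequence of elements whose
consecutive terms are comparable. -/
def PosetConnected (X : Type*) [PartialOrder X] : Prop :=
  ∀ x y : X, Relation.ReflTransGen (fun a b : X => a ≤ b ∨ b ≤ a) x y

/-! ### The finitary incidence algebra -/

/-- For `x y : X`, the pairs `(u, v)` with `u ≠ v` and `f (u, v) ≠ 0` such that `[u, v]` is a
subinterval of `[x, y]` (`u ≤ v` is automatic, as `f` vanishes off the order relation). -/
def nonzeroSubintervals {K X : Type*} [Field K] [PartialOrder X] (f : IncidenceAlgebra K X)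
    (x y : X) : Set (X × X) :=
  {p | x ≤ p.1 ∧ p.2 ≤ y ∧ p.1 ≠ p.2 ∧ f p.1 p.2 ≠ 0}

/-- The subspace `FI(X, K)` of the incidence space `I(X, K)`. (The type `IncidenceAlgebra K X` of
functions `f : X → X → K` with `f x y = 0` unless `x ≤ y` is a `K`-space for every poset `X`; its
product, which needs `X` locally finite, is not used here.) -/
def finitarySubmodule (K X : Type*) [Field K] [PartialOrder X] :
    Submodule K (IncidenceAlgebra K X) where
  carrier := {f | ∀ x y : X, x ≤ y → (nonzeroSubintervals f x y).Finite}
  zero_mem' x y _ := by simp [nonzeroSubintervals]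
  add_mem' {f g} hf hg x y h := by
    refine ((hf x y h).union (hg x y h)).subset ?_
    rintro p ⟨h1, h2, h3, h4⟩
    by_cases hfp : f p.1 p.2 = 0
    · refine Or.inr ⟨h1, h2, h3, fun hgp => h4 ?_⟩
      rw [IncidenceAlgebra.add_apply, hfp, hgp, add_zero]
    · exact Or.inl ⟨h1, h2, h3, hfp⟩
  smul_mem' c f hf x y h := by
    refine (hf x y h).subset ?_
    rintro p ⟨h1, h2, h3, h4⟩
    refine ⟨h1, h2, h3, fun hfp => h4 ?_⟩
    rw [IncidenceAlgebra.constSMul_apply, hfp, smul_zero]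

/-- The finitary incidence algebra `FI(X, K)`; its product is defined below. -/
abbrev FI (X K : Type*) [PartialOrder X] [Field K] : Type _ := ↥(finitarySubmodule K X)

namespace FI

variable {X K : Type*} [PartialOrder X] [Field K]

instance : CoeFun (FI X K) (fun _ => X → X → K) := ⟨fun f => f.1⟩

theorem ext' {f g : FI X K} (h : ∀ x y, x ≤ y → f x y = g x y) : f = g :=
  Subtype.ext (IncidenceAlgebra.ext h)

theorem le_of_ne_zero (f : FI X K) {x y : X} (h : f x y ≠ 0) : x ≤ y :=
  IncidenceAlgebra.le_of_ne_zero h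

theorem apply_of_not_le (f : FI X K) {x y : X} (h : ¬ x ≤ y) : f x y = 0 :=
  IncidenceAlgebra.apply_eq_zero_of_not_le h _

theorem finite (f : FI X K) (x y : X) : (nonzeroSubintervals f.1 x y).Finite := by
  by_cases h : x ≤ y
  · exact f.2 x y h
  · refine Set.finite_empty.subset ?_
    rintro p ⟨h1, h2, -, h4⟩
    exact h (h1.trans ((IncidenceAlgebra.le_of_ne_zero h4).trans h2))

@[simp] theorem zero_apply (x y : X) : (0 : FI X K) x y = 0 := rfl

@[simp] theorem add_apply (f g : FI X K) (x y : X) : (f + g) x y = f x y + g x y := rfl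

@[simp] theorem smul_apply (c : K) (f : FI X K) (x y : X) : (c • f) x y = c * f x y := rfl

/-- The convolution `∑_{x ≤ z ≤ y} f(x,z) g(z,y)` of two elements of `FI(X, K)`; the sum has only
finitely many nonzero terms. -/
noncomputable def conv (f g : FI X K) (x y : X) : K := ∑ᶠ z ∈ Set.Icc x y, f x z * g z y

theorem conv_support_finite (f g : FI X K) (x y : X) :
    {z | z ∈ Set.Icc x y ∧ f x z * g z y ≠ 0}.Finite := by
  refine ((Set.finite_singleton x).union ((FI.finite f x y).image Prod.snd)).subset ?_
  rintro z ⟨hz, hfg⟩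
  by_cases h : z = x
  · exact Or.inl h
  · exact Or.inr ⟨(x, z), ⟨le_rfl, hz.2, Ne.symm h, left_ne_zero_of_mul hfg⟩, rfl⟩

theorem conv_eq_sum (f g : FI X K) (x y : X) (T : Finset X)
    (hT : ∀ z, f x z ≠ 0 → g z y ≠ 0 → z ∈ T) : conv f g x y = ∑ z ∈ T, f x z * g z y := by
  have h1 : conv f g x y = ∑ᶠ z, f x z * g z y := by
    refine finsum_congr fun z => ?_
    by_cases hz : z ∈ Set.Icc x y
    · simp [hz]
    · have h0 : f x z * g z y = 0 := by
        by_contra h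
        exact hz ⟨le_of_ne_zero f (left_ne_zero_of_mul h),
          le_of_ne_zero g (right_ne_zero_of_mul h)⟩
      rw [h0]
      simp
  rw [h1]
  refine finsum_eq_sum_of_support_subset _ fun z hz => ?_
  exact hT z (left_ne_zero_of_mul hz) (right_ne_zero_of_mul hz)

theorem exists_of_conv_ne_zero {f g : FI X K} {x y : X} (h : conv f g x y ≠ 0) :
    ∃ z, f x z ≠ 0 ∧ g z y ≠ 0 := by
  by_contra! H
  refine h ?_
  rw [conv_eq_sum f g x y ∅ (fun z h1 h2 => absurd (H z h1) h2), Finset.sum_empty]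

noncomputable instance : Mul (FI X K) where
  mul f g := ⟨⟨conv f g, fun x y hxy => by
      by_contra h
      obtain ⟨z, h1, h2⟩ := exists_of_conv_ne_zero h
      exact hxy ((FI.le_of_ne_zero f h1).trans (FI.le_of_ne_zero g h2))⟩, by
    intro x y _
    refine (((FI.finite f x y).union (FI.finite g x y)).union
      (((FI.finite f x y).prod (FI.finite g x y)).image fun q => (q.1.1, q.2.2))).subset ?_
    rintro ⟨a, b⟩ ⟨ha, hb, hab, hne⟩
    obtain ⟨z, h1, h2⟩ := exists_of_conv_ne_zero (f := f) (g := g) hne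
    have haz := FI.le_of_ne_zero f h1
    have hzb := FI.le_of_ne_zero g h2
    by_cases hza : z = a
    · subst hza
      exact Or.inl (Or.inr ⟨ha, hb, hab, h2⟩)
    by_cases hzb' : z = b
    · subst hzb'
      exact Or.inl (Or.inl ⟨ha, hb, hab, h1⟩)
    · exact Or.inr ⟨((a, z), (z, b)),
        ⟨⟨ha, hzb.trans hb, Ne.symm hza, h1⟩, ⟨ha.trans haz, hb, hzb', h2⟩⟩, rfl⟩⟩

theorem mul_apply (f g : FI X K) (x y : X) :
    (f * g) x y = ∑ᶠ z ∈ Set.Icc x y, f x z * g z y := rfl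

theorem mul_apply_sum (f g : FI X K) (x y : X) (T : Finset X)
    (hT : ∀ z, f x z ≠ 0 → g z y ≠ 0 → z ∈ T) : (f * g) x y = ∑ z ∈ T, f x z * g z y :=
  conv_eq_sum f g x y T hT

open Classical in
/-- The identity element `δ`. -/
noncomputable instance : One (FI X K) where
  one := ⟨⟨fun x y => if x = y then 1 else 0, fun x y h => by
      rw [if_neg (fun e => h e.le)]⟩, by
    intro x y _
    refine Set.finite_empty.subset ?_
    rintro p ⟨-, -, h1, h2⟩
    exact h2 (if_neg h1)⟩

open Classical in
theorem one_apply (x y : X) : (1 : FI X K) x y = if x = y then 1 else 0 := rfl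

/-- A finite set of points containing everything that is relevant to sums over `[x, y]`. -/
theorem exists_finset (f : FI X K) (x y : X) :
    ∃ T : Finset X, ∀ u v, x ≤ u → v ≤ y → u ≠ v → f u v ≠ 0 → u ∈ T ∧ v ∈ T := by
  classical
  refine ⟨(FI.finite f x y).toFinset.image Prod.fst ∪ (FI.finite f x y).toFinset.image Prod.snd, ?_⟩
  intro u v h1 h2 h3 h4
  have h : (u, v) ∈ nonzeroSubintervals f.1 x y := ⟨h1, h2, h3, h4⟩
  simp only [Finset.mem_union, Finset.mem_image, Set.Finite.mem_toFinset]
  exact ⟨Or.inl ⟨_, h, rfl⟩, Or.inr ⟨_, h, rfl⟩⟩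

protected theorem mul_assoc (f g h : FI X K) : f * g * h = f * (g * h) := by
  classical
  refine ext' fun x y _ => ?_
  obtain ⟨Tf, hTf⟩ := FI.exists_finset f x y
  obtain ⟨Th, hTh⟩ := FI.exists_finset h x y
  set T : Finset X := insert x (insert y (Tf ∪ Th)) with hT
  have key1 : ∀ z, z ≤ y → f x z ≠ 0 → z ∈ T := by
    intro z hzy hf
    by_cases hxz : x = z
    · simp [hT, hxz]
    · have := (hTf x z le_rfl hzy hxz hf).2
      simp [hT, this]
  have key2 : ∀ z, x ≤ z → h z y ≠ 0 → z ∈ T := by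
    intro z hxz hh
    by_cases hzy : z = y
    · simp [hT, hzy]
    · have := (hTh z y hxz le_rfl hzy hh).1
      simp [hT, this]
  rw [mul_apply_sum (f * g) h x y T (fun z h1 h2 => key2 z (le_of_ne_zero _ h1) h2),
    mul_apply_sum f (g * h) x y T (fun z h1 h2 => key1 z (le_of_ne_zero _ h2) h1)]
  have e1 : ∀ z ∈ T, (f * g) x z * h z y = ∑ w ∈ T, f x w * g w z * h z y := by
    intro z _
    by_cases hz : h z y = 0
    · simp [hz]
    · rw [mul_apply_sum f g x z T (fun w h1 h2 =>
        key1 w ((FI.le_of_ne_zero g h2).trans (FI.le_of_ne_zero h hz)) h1), Finset.sum_mul]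
  have e2 : ∀ w ∈ T, f x w * (g * h) w y = ∑ z ∈ T, f x w * g w z * h z y := by
    intro w _
    by_cases hw : f x w = 0
    · simp [hw]
    · rw [mul_apply_sum g h w y T (fun z h1 h2 =>
        key2 z ((FI.le_of_ne_zero f hw).trans (FI.le_of_ne_zero g h1)) h2), Finset.mul_sum]
      exact Finset.sum_congr rfl fun z _ => by ring
  rw [Finset.sum_congr rfl e1, Finset.sum_congr rfl e2, Finset.sum_comm]

noncomputable instance : Ring (FI X K) :=
  { (inferInstance : AddCommGroup (FI X K)), (inferInstance : Mul (FI X K)),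
    (inferInstance : One (FI X K)) with
    mul_assoc := FI.mul_assoc
    one_mul := fun f => by
      classical
      refine ext' fun x y _ => ?_
      rw [mul_apply_sum 1 f x y {x} (fun z h1 _ => ?_)]
      · simp [one_apply]
      · rw [one_apply] at h1
        simp only [ne_eq, ite_eq_right_iff, one_ne_zero, imp_false, not_not] at h1
        simp [h1]
    mul_one := fun f => by
      classical
      refine ext' fun x y _ => ?_
      rw [mul_apply_sum f 1 x y {y} (fun z _ h1 => ?_)]
      · simp [one_apply]
      · rw [one_apply] at h1
        simp only [ne_eq, ite_eq_right_iff, one_ne_zero, imp_false, not_not] at h1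
        simp [h1]
    zero_mul := fun f => by
      refine ext' fun x y _ => ?_
      rw [mul_apply_sum 0 f x y ∅ (fun z h1 _ => absurd rfl h1)]
      simp
    mul_zero := fun f => by
      refine ext' fun x y _ => ?_
      rw [mul_apply_sum f 0 x y ∅ (fun z _ h1 => absurd rfl h1)]
      simp
    left_distrib := fun f g h => by
      classical
      refine ext' fun x y _ => ?_
      obtain ⟨T, hT⟩ := FI.exists_finset f x y
      have key : ∀ z, z ≤ y → f x z ≠ 0 → z ∈ insert x T := by
        intro z hzy hf
        by_cases hxz : x = z
        · simp [hxz]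
        · simp [(hT x z le_rfl hzy hxz hf).2]
      rw [add_apply, mul_apply_sum f (g + h) x y _ (fun z h1 h2 => key z (le_of_ne_zero _ h2) h1),
        mul_apply_sum f g x y _ (fun z h1 h2 => key z (le_of_ne_zero _ h2) h1),
        mul_apply_sum f h x y _ (fun z h1 h2 => key z (le_of_ne_zero _ h2) h1),
        ← Finset.sum_add_distrib]
      exact Finset.sum_congr rfl fun z _ => by rw [add_apply, mul_add]
    right_distrib := fun f g h => by
      classical
      refine ext' fun x y _ => ?_
      obtain ⟨T, hT⟩ := FI.exists_finset h x y
      have key : ∀ z, x ≤ z → h z y ≠ 0 → z ∈ insert y T := by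
        intro z hxz hh
        by_cases hzy : z = y
        · simp [hzy]
        · simp [(hT z y hxz le_rfl hzy hh).1]
      rw [add_apply, mul_apply_sum (f + g) h x y _ (fun z h1 h2 => key z (le_of_ne_zero _ h1) h2),
        mul_apply_sum f h x y _ (fun z h1 h2 => key z (le_of_ne_zero _ h1) h2),
        mul_apply_sum g h x y _ (fun z h1 h2 => key z (le_of_ne_zero _ h1) h2),
        ← Finset.sum_add_distrib]
      exact Finset.sum_congr rfl fun z _ => by rw [add_apply, add_mul] }

noncomputable instance : Algebra K (FI X K) :=
  Algebra.ofModule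
    (fun c f g => by
      classical
      refine ext' fun x y _ => ?_
      have hS := conv_support_finite f g x y
      have key : ∀ z, f x z ≠ 0 → g z y ≠ 0 → z ∈ hS.toFinset := fun z h1 h2 => by
        simpa using ⟨⟨FI.le_of_ne_zero f h1, FI.le_of_ne_zero g h2⟩, h1, h2⟩
      rw [smul_apply, mul_apply_sum f g x y _ key, mul_apply_sum (c • f) g x y _
        (fun z h1 h2 => key z (right_ne_zero_of_mul h1) h2), Finset.mul_sum]
      exact Finset.sum_congr rfl fun z _ => by rw [smul_apply, mul_assoc])
    (fun c f g => by
      classical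
      refine ext' fun x y _ => ?_
      have hS := conv_support_finite f g x y
      have key : ∀ z, f x z ≠ 0 → g z y ≠ 0 → z ∈ hS.toFinset := fun z h1 h2 => by
        simpa using ⟨⟨FI.le_of_ne_zero f h1, FI.le_of_ne_zero g h2⟩, h1, h2⟩
      rw [smul_apply, mul_apply_sum f g x y _ key, mul_apply_sum f (c • g) x y _
        (fun z h1 h2 => key z h1 (right_ne_zero_of_mul h2)), Finset.mul_sum]
      exact Finset.sum_congr rfl fun z _ => by rw [smul_apply]; ring)

open Classical in
/-- The idempotent `e_x` of `FI(X, K)`: it is `1` at `(x, x)` and `0` elsewhere. -/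
noncomputable def e (K : Type*) [Field K] (x : X) : FI X K :=
  ⟨⟨fun u v => if u = x ∧ v = x then 1 else 0, fun u v h =>
      if_neg (fun h' => h (h'.1.trans h'.2.symm).le)⟩, by
    intro a b _
    refine Set.finite_empty.subset ?_
    rintro p ⟨-, -, h1, h2⟩
    exact h2 (if_neg fun h' => h1 (h'.1.trans h'.2.symm))⟩

/-- The map `ρ` on `FI(X, K)` induces `l : X → X` if, for every `x`, the point `l x` is the one and
only `y` for which `ρ(e_x)` is conjugate to `e_y`, i.e. `ρ(e_x) = f e_y f⁻¹` for an invertible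
`f`. -/
def Induces (ρ : FI X K → FI X K) (l : X → X) : Prop :=
  ∀ x y : X, (∃ f : (FI X K)ˣ, ρ (e K x) = f * e K y * (f⁻¹ : (FI X K)ˣ)) ↔ y = l x

/-- `σ ∈ I(X, K)` is multiplicative: it does not vanish at any `x ≤ y`, and
`σ(x,y) σ(y,z) = σ(x,z)` whenever `x ≤ y ≤ z`. -/
structure IsMultiplicative (σ : IncidenceAlgebra K X) : Prop where
  ne_zero : ∀ x y, x ≤ y → σ x y ≠ 0
  mul : ∀ x y z, x ≤ y → y ≤ z → σ x y * σ y z = σ x z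

/-- The pointwise product of `s` and `f ∈ FI(X, K)`. -/
def pointwise (s : X → X → K) (f : FI X K) : FI X K :=
  ⟨⟨fun x y => s x y * f x y, fun x y h => by rw [FI.apply_of_not_le f h, mul_zero]⟩, by
    intro x y _
    refine (FI.finite f x y).subset ?_
    rintro p ⟨h1, h2, h3, h4⟩
    exact ⟨h1, h2, h3, right_ne_zero_of_mul h4⟩⟩

@[simp] theorem pointwise_apply (s : X → X → K) (f : FI X K) (x y : X) :
    pointwise s f x y = s x y * f x y := rfl

/-- The multiplicative automorphism `M_σ` of `FI(X, K)`, `M_σ(f)(x,y) = σ(x,y) f(x,y)`. -/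
noncomputable def multAut (σ : IncidenceAlgebra K X) (hσ : IsMultiplicative σ) : FI X K ≃ₐ[K] FI X K :=
  AlgEquiv.ofLinearEquiv
    { toFun := pointwise σ
      invFun := pointwise fun x y => (σ x y)⁻¹
      left_inv := fun f => ext' fun x y h => by
        simp [← mul_assoc, inv_mul_cancel₀ (hσ.ne_zero x y h)]
      right_inv := fun f => ext' fun x y h => by
        simp [← mul_assoc, mul_inv_cancel₀ (hσ.ne_zero x y h)]
      map_add' := fun f g => ext' fun x y _ => by simp [mul_add]
      map_smul' := fun c f => ext' fun x y _ => by
        simp only [pointwise_apply, smul_apply, RingHom.id_apply]; ring }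
    (by
      classical
      refine ext' fun x y _ => ?_
      change σ x y * (1 : FI X K) x y = (1 : FI X K) x y
      rw [one_apply]
      split_ifs with h
      · subst h
        have h1 := hσ.mul x x x le_rfl le_rfl
        rw [mul_one]
        exact mul_right_cancel₀ (hσ.ne_zero x x le_rfl) (by rw [h1, one_mul])
      · simp)
    (by
      classical
      intro f g
      refine ext' fun x y _ => ?_
      change σ x y * (f * g) x y = (pointwise σ f * pointwise σ g) x y
      have hS := conv_support_finite f g x y
      have key : ∀ z, f x z ≠ 0 → g z y ≠ 0 → z ∈ hS.toFinset := fun z h1 h2 => by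
        simpa using ⟨⟨FI.le_of_ne_zero f h1, FI.le_of_ne_zero g h2⟩, h1, h2⟩
      rw [mul_apply_sum f g x y _ key, mul_apply_sum (pointwise σ f) (pointwise σ g) x y _
        (fun z h1 h2 => key z (right_ne_zero_of_mul h1) (right_ne_zero_of_mul h2)),
        Finset.mul_sum]
      refine Finset.sum_congr rfl fun z hz => ?_
      have hz' : z ∈ Set.Icc x y := (hS.mem_toFinset.1 hz).1
      rw [pointwise_apply, pointwise_apply, ← hσ.mul x z y hz'.1 hz'.2]
      ring)

theorem multAut_apply (σ : IncidenceAlgebra K X) (hσ : IsMultiplicative σ) (f : FI X K)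
    (x y : X) : multAut σ hσ f x y = σ x y * f x y := rfl

/-- Every multiplicative automorphism of `FI(X, K)` is inner. -/
def MultAutsInner (X K : Type*) [PartialOrder X] [Field K] : Prop :=
  ∀ (σ : IncidenceAlgebra K X) (hσ : IsMultiplicative σ),
    ∃ u : (FI X K)ˣ, multAut σ hσ = innerAut K u

end FI

/-! Everything is read off the diagonal. The map `f ↦ f x x` is multiplicative with values in a
field, so conjugation does not change it (`conj_apply_self`). The idempotent `ρ(e_x)` has diagonal
entries 0 or 1, and they are not all 0, since an idempotent with zero diagonal vanishes. If the
entry at `y` is 1, then `e_y` and `ρ(e_x)` satisfy `efe = e` and `fef = f`, because the corner of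
the algebra at a single point is one-dimensional; such idempotents are conjugate. Hence `y` is
unique, and `x ↦ y` reverses the order because `x ≤ y` means that the corner `e_x FI e_y` is
nonzero.

If `Ψ_u` intertwines the involutions, `ρ₁(e_x)` and `ρ₂(e_x)` are conjugate, so they have the same
diagonal and yield the same `y`. Scalars and their images are central, so on them the conjugations
by `u` disappear. -/

/-! ### Conjugacy of idempotents in a ring. -/

/-- Two idempotents `e`, `f` of a ring with `e f e = e` and `f e f = f` are conjugate. -/
theorem exists_unit_conj_of_mul_mul_eq {A : Type*} [Ring A] {e f : A} (he : e * e = e)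
    (hf : f * f = f) (hefe : e * f * e = e) (hfef : f * e * f = f) :
    ∃ g : Aˣ, f = g * e * (g⁻¹ : Aˣ) := by
  -- The conjugating element is `fe + (1-f)(1-e)`. Its product with the mirror element is `1 - n`,
  -- where `n = (1-b)a(1-b)` has square zero, so the factor `1 + n` completes a right inverse.
  have hr : ∀ a b : A, a * a = a → b * b = b → a * b * a = a → b * a * b = b →
      (b * a + (1 - b) * (1 - a)) *
        ((a * b + (1 - a) * (1 - b)) * (1 + (1 - b) * a * (1 - b))) = 1 := by
    intro a b ha hb hab hba
    have h1 : (b * a + (1 - b) * (1 - a)) * (a * b + (1 - a) * (1 - b))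
        = 1 - (1 - b) * a * (1 - b) := by
      have hba' : b * (a * b) = b := by rw [← mul_assoc, hba]
      have haz : ∀ z, a * (a * z) = a * z := fun z => by rw [← mul_assoc, ha]
      simp only [mul_add, add_mul, mul_sub, sub_mul, mul_one, one_mul, mul_assoc, ha, hb, hba', haz]
      abel
    have h2 : ((1 - b) * a * (1 - b)) * ((1 - b) * a * (1 - b)) = 0 := by
      have hab' : a * (b * a) = a := by rw [← mul_assoc, hab]
      have hba' : b * (a * b) = b := by rw [← mul_assoc, hba]
      have haz : ∀ z, a * (a * z) = a * z := fun z => by rw [← mul_assoc, ha]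
      have hbz : ∀ z, b * (b * z) = b * z := fun z => by rw [← mul_assoc, hb]
      simp only [mul_sub, sub_mul, mul_one, one_mul, mul_assoc, ha, hb, hab', hba', haz, hbz]
      abel
    rw [← mul_assoc, h1, sub_mul, one_mul, mul_add, mul_one, h2, add_zero, add_sub_cancel_right]
  have hu := hr e f he hf hefe hfef
  have hv := hr f e hf he hfef hefe
  -- Exchanging `e` and `f` gives `v * (u * w) = 1` with `w` unipotent, hence invertible; then `w *
  -- v` is a left inverse of `u`.
  have hu' : IsUnit (f * e + (1 - f) * (1 - e)) := by
    have hw : IsUnit (1 + (1 - e) * f * (1 - e)) := by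
      have hsq : ((1 - e) * f * (1 - e)) * ((1 - e) * f * (1 - e)) = 0 := by
        have h0 : (1 - e) * (1 - e) = 1 - e := by
          simp only [mul_sub, sub_mul, mul_one, one_mul, he]; abel
        calc _ = (1 - e) * f * ((1 - e) * (1 - e)) * f * (1 - e) := by simp only [mul_assoc]
          _ = (1 - e) * (f * f - f * e * f) * (1 - e) := by
            rw [h0]; simp only [mul_sub, sub_mul, mul_one, mul_assoc]
          _ = 0 := by rw [hf, hfef]; simp
      exact IsNilpotent.isUnit_one_add ⟨2, by rw [pow_two, hsq]⟩
    rw [← mul_assoc] at hv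
    obtain ⟨w, hw⟩ := hw
    rw [← hw] at hv
    have hv' : (e * f + (1 - e) * (1 - f)) * (f * e + (1 - f) * (1 - e)) = (w⁻¹ : Aˣ) :=
      Units.eq_inv_of_mul_eq_one_right hv
    refine isUnit_iff_exists_and_exists.2 ⟨⟨_, hu⟩, ⟨w * (e * f + (1 - e) * (1 - f)), ?_⟩⟩
    rw [mul_assoc, hv', Units.mul_inv]
  obtain ⟨g, hg⟩ := hu'
  refine ⟨g, ?_⟩
  rw [Units.eq_mul_inv_iff_mul_eq, hg]
  have hez : f * (f * e) = f * e := by rw [← mul_assoc, hf]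
  simp only [mul_add, add_mul, mul_sub, sub_mul, mul_one, one_mul, mul_assoc, he, hf, hez]
  abel

/-! ### Formal properties of ring involutions. -/

namespace IsAlgInvolution

variable {A : Type*} [Ring A] {ρ : A → A}

theorem map_zero (h : IsAlgInvolution ρ) : ρ 0 = 0 := by
  have := h.map_add 0 0
  rwa [add_zero, left_eq_add] at this

theorem map_one (h : IsAlgInvolution ρ) : ρ 1 = 1 := by
  have := h.map_mul_rev (ρ 1) 1
  rwa [mul_one, h.involutive, mul_one, eq_comm] at this

/-- An involution maps units to units. -/
def mapUnit (h : IsAlgInvolution ρ) (g : Aˣ) : Aˣ where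
  val := ρ g
  inv := ρ (g⁻¹ : Aˣ)
  val_inv := by rw [← h.map_mul_rev, Units.inv_mul, h.map_one]
  inv_val := by rw [← h.map_mul_rev, Units.mul_inv, h.map_one]

theorem map_conj (h : IsAlgInvolution ρ) (g : Aˣ) (a : A) :
    ρ (g * a * (g⁻¹ : Aˣ)) = ((h.mapUnit g)⁻¹ : Aˣ) * ρ a * h.mapUnit g := by
  rw [h.map_mul_rev, h.map_mul_rev, ← mul_assoc]
  rfl

theorem commute_map (h : IsAlgInvolution ρ) {a : A} (ha : ∀ b, Commute a b) (b : A) :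
    Commute (ρ a) b := by
  rw [← h.involutive b]
  unfold Commute SemiconjBy
  rw [← h.map_mul_rev, ← h.map_mul_rev, (ha (ρ b)).eq]

end IsAlgInvolution

/-! ### Diagonals, corners and idempotents of the incidence algebra. -/

namespace FI

variable {X K : Type*} [PartialOrder X] [Field K]

theorem mul_apply_self (f g : FI X K) (x : X) : (f * g) x x = f x x * g x x := by
  rw [mul_apply_sum f g x x {x} fun z h1 h2 =>
    Finset.mem_singleton.2 ((le_of_ne_zero g h2).antisymm (le_of_ne_zero f h1)),
    Finset.sum_singleton]

theorem one_apply_self (x : X) : (1 : FI X K) x x = 1 := by simp [one_apply]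

/-- Diagonal entries multiply in the commutative field `K`, so those of `g` and `g⁻¹` cancel. This
is the invariant that distinguishes the conjugacy classes of the `e_y`. -/
theorem conj_apply_self (g : (FI X K)ˣ) (f : FI X K) (x : X) :
    ((g : FI X K) * f * ((g⁻¹ : (FI X K)ˣ) : FI X K)) x x = f x x := by
  have h : (g : FI X K) x x * ((g⁻¹ : (FI X K)ˣ) : FI X K) x x = 1 := by
    rw [← mul_apply_self, Units.mul_inv, one_apply_self]
  rw [mul_apply_self, mul_apply_self, mul_right_comm, h, one_mul]

open Classical in
theorem e_apply (x u v : X) : e K x u v = if u = x ∧ v = x then 1 else 0 := rfl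

theorem e_apply_self (x : X) : e K x x x = 1 := by simp [e_apply]

theorem e_apply_of_ne {x y : X} (h : y ≠ x) : e K x y y = 0 := by simp [e_apply, h]

theorem e_mul_apply_self (x : X) (f : FI X K) (y : X) : (e K x * f) x y = f x y := by
  rw [mul_apply_sum _ f x y {x} (fun z h1 _ => ?_), Finset.sum_singleton, e_apply_self, one_mul]
  by_contra h
  exact h1 (if_neg fun h' => h (Finset.mem_singleton.2 h'.2))

theorem e_mul_apply_of_ne {x u : X} (h : u ≠ x) (f : FI X K) (y : X) : (e K x * f) u y = 0 := by
  rw [mul_apply_sum _ f u y ∅ (fun z h1 _ => absurd (if_neg fun h' => h h'.1) h1),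
    Finset.sum_empty]

theorem mul_e_apply_self (f : FI X K) (x y : X) : (f * e K y) x y = f x y := by
  rw [mul_apply_sum f _ x y {y} (fun z _ h1 => ?_), Finset.sum_singleton, e_apply_self, mul_one]
  by_contra h
  exact h1 (if_neg fun h' => h (Finset.mem_singleton.2 h'.1))

theorem mul_e_apply_of_ne {y v : X} (h : v ≠ y) (f : FI X K) (x : X) : (f * e K y) x v = 0 := by
  rw [mul_apply_sum f _ x v ∅ (fun z _ h1 => absurd (if_neg fun h' => h h'.2) h1),
    Finset.sum_empty]

theorem e_mul_mul_e_apply (f : FI X K) (x y : X) : (e K x * f * e K y) x y = f x y := by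
  rw [mul_e_apply_self, e_mul_apply_self]

/-- The two-sided product keeps only the entry at `(x, y)`. -/
theorem e_mul_mul_e_eq_zero_iff (f : FI X K) (x y : X) : e K x * f * e K y = 0 ↔ f x y = 0 := by
  refine ⟨fun h => by rw [← e_mul_mul_e_apply f x y, h, zero_apply], fun h => ext' fun a b _ => ?_⟩
  rw [zero_apply]
  by_cases hb : b = y
  · subst hb
    by_cases ha : a = x
    · rw [ha, e_mul_mul_e_apply, h]
    · rw [mul_e_apply_self, e_mul_apply_of_ne ha]
  · exact mul_e_apply_of_ne hb _ _

theorem e_mul_mul_e_self {f : FI X K} {x : X} (h : f x x = 1) : e K x * f * e K x = e K x := by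
  refine ext' fun a b _ => ?_
  by_cases hb : b = x
  · subst hb
    by_cases ha : a = b
    · rw [ha, e_mul_mul_e_apply, h, e_apply_self]
    · rw [mul_e_apply_self, e_mul_apply_of_ne ha, e_apply, if_neg fun h' => ha h'.1]
  · rw [mul_e_apply_of_ne hb, e_apply, if_neg fun h' => hb h'.2]

theorem e_mul_e (x : X) : e K x * e K x = e K x := by
  simpa using e_mul_mul_e_self (one_apply_self (K := K) x)

/-- `e_x FI(X, K) e_y` is nonzero exactly when `x ≤ y`. -/
theorem le_iff_exists_e_mul_mul_e_ne_zero (x y : X) :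
    x ≤ y ↔ ∃ f : FI X K, e K x * f * e K y ≠ 0 := by
  classical
  constructor
  · intro h
    refine ⟨⟨⟨fun u v => if u = x ∧ v = y then 1 else 0, fun u v huv => if_neg ?_⟩, ?_⟩, ?_⟩
    · rintro ⟨rfl, rfl⟩
      exact huv h
    · intro a b _
      refine (Set.finite_singleton (x, y)).subset ?_
      rintro p ⟨-, -, -, hp⟩
      by_contra hne
      exact hp (if_neg fun h' => hne (Prod.ext h'.1 h'.2))
    · rw [Ne, e_mul_mul_e_eq_zero_iff]
      change (if x = x ∧ y = y then (1 : K) else 0) ≠ 0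
      simp
  · rintro ⟨f, hf⟩
    exact le_of_ne_zero f fun h => hf ((e_mul_mul_e_eq_zero_iff f x y).2 h)

theorem apply_self_eq_zero_or_one {f : FI X K} (hf : f * f = f) (x : X) :
    f x x = 0 ∨ f x x = 1 := by
  have h := mul_apply_self f f x
  rw [hf] at h
  by_cases h0 : f x x = 0
  · exact Or.inl h0
  · exact Or.inr (mul_left_cancel₀ h0 (by rw [← h, mul_one]))

/-- An idempotent of `FI(X, K)` with zero diagonal vanishes. -/
theorem eq_zero_of_idempotent_of_apply_self {f : FI X K} (hf : f * f = f)
    (h0 : ∀ x, f x x = 0) : f = 0 := by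
  -- Induction on the number of nonzero off-diagonal entries within `[x, y]`.
  suffices H : ∀ (n : ℕ) (x y : X), (nonzeroSubintervals f.1 x y).ncard ≤ n → f x y = 0 from
    ext' fun x y _ => H _ x y le_rfl
  intro n
  induction n with
  | zero =>
    intro x y hn
    by_contra hne
    have hmem : (x, y) ∈ nonzeroSubintervals f.1 x y :=
      ⟨le_rfl, le_rfl, fun h : x = y => hne (h ▸ h0 x), hne⟩
    rw [Nat.le_zero, Set.ncard_eq_zero (FI.finite f x y)] at hn
    rw [hn] at hmem
    exact hmem
  | succ n ih =>
    intro x y hn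
    by_contra hne
    have hconv : conv f f x y ≠ 0 := by
      change (f * f) x y ≠ 0
      rwa [hf]
    obtain ⟨z, h1, h2⟩ := exists_of_conv_ne_zero hconv
    -- The zero diagonal forces `z ≠ y`, so `[x, z]` no longer contains the pair `(x, y)` and the
    -- count drops.
    refine h1 (ih x z (Nat.le_of_lt_succ (lt_of_lt_of_le ?_ hn)))
    have hzy : z ≤ y := FI.le_of_ne_zero f h2
    refine Set.ncard_lt_ncard ⟨fun p hp => ⟨hp.1, hp.2.1.trans hzy, hp.2.2⟩, fun hsub => ?_⟩
      (FI.finite f x y)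
    have hmem : (x, y) ∈ nonzeroSubintervals f.1 x z :=
      hsub ⟨le_rfl, le_rfl, fun h : x = y => hne (h ▸ h0 x), hne⟩
    have hyz : y = z := le_antisymm hmem.2.1 hzy
    exact h2 (hyz ▸ h0 y)

/-! ### The poset involution read off the diagonals of `ρ(e_x)`. -/

section Involution

variable {ρ : FI X K → FI X K}

theorem map_e_mul_map_e (hρ : IsAlgInvolution ρ) (x : X) :
    ρ (e K x) * ρ (e K x) = ρ (e K x) := by
  rw [← hρ.map_mul_rev, e_mul_e]

theorem exists_map_e_apply_self (hρ : IsAlgInvolution ρ) (x : X) :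
    ∃ y, ρ (e K x) y y = 1 := by
  by_contra! H
  have h0 : ρ (e K x) = 0 := eq_zero_of_idempotent_of_apply_self (map_e_mul_map_e hρ x)
    fun y => (apply_self_eq_zero_or_one (map_e_mul_map_e hρ x) y).resolve_right (H y)
  have h1 : e K x = 0 := by rw [← hρ.involutive (e K x), h0, hρ.map_zero]
  have h2 := e_apply_self (K := K) x
  rw [h1, zero_apply] at h2
  exact zero_ne_one h2

/-- If the diagonal of `ρ(e_x)` is nonzero at `y`, then `ρ(e_x)` is conjugate to `e_y`. -/
theorem map_e_conj (hρ : IsAlgInvolution ρ) {x y : X} (h : ρ (e K x) y y = 1) :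
    ∃ g : (FI X K)ˣ, ρ (e K x) = g * e K y * (g⁻¹ : (FI X K)ˣ) := by
  -- Moving the product through `ρ` turns it into the image of a corner at `x`, which is either 0 or
  -- `e_x`; the value 0 is excluded by the diagonal entry at `y`.
  have hρe : ρ (e K x) * e K y * ρ (e K x) = ρ (e K x * ρ (e K y) * e K x) := by
    rw [hρ.map_mul_rev, hρ.map_mul_rev, hρ.involutive, mul_assoc]
  refine exists_unit_conj_of_mul_mul_eq (e_mul_e y) (map_e_mul_map_e hρ x)
    (e_mul_mul_e_self h) ?_
  rw [hρe]
  rcases apply_self_eq_zero_or_one (map_e_mul_map_e hρ y) x with h0 | h1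
  · rw [(e_mul_mul_e_eq_zero_iff _ x x).2 h0, hρ.map_zero] at hρe
    have h2 : (ρ (e K x) * e K y * ρ (e K x)) y y = 1 := by
      rw [mul_apply_self, mul_apply_self, h, e_apply_self, one_mul, one_mul]
    rw [hρe, zero_apply] at h2
    exact absurd h2 zero_ne_one
  · rw [e_mul_mul_e_self h1]

theorem map_e_conj_iff (hρ : IsAlgInvolution ρ) (x y : X) :
    (∃ g : (FI X K)ˣ, ρ (e K x) = g * e K y * (g⁻¹ : (FI X K)ˣ)) ↔ ρ (e K x) y y = 1 := by
  refine ⟨?_, map_e_conj hρ⟩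
  rintro ⟨g, hg⟩
  rw [hg, conj_apply_self, e_apply_self]

theorem eq_of_map_e_apply_self (hρ : IsAlgInvolution ρ) {x y z : X} (hy : ρ (e K x) y y = 1)
    (hz : ρ (e K x) z z = 1) : z = y := by
  obtain ⟨g, hg⟩ := map_e_conj hρ hy
  by_contra hne
  rw [hg, conj_apply_self, e_apply_of_ne hne] at hz
  exact zero_ne_one hz

/-- Applying `ρ` to `ρ(e_x) = g e_y g⁻¹` makes `e_x` a conjugate of `ρ(e_y)`. -/
theorem map_e_apply_self_symm (hρ : IsAlgInvolution ρ) {x y : X} (h : ρ (e K x) y y = 1) :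
    ρ (e K y) x x = 1 := by
  obtain ⟨g, hg⟩ := map_e_conj hρ h
  have h1 := congrArg ρ hg
  rw [hρ.involutive, hρ.map_conj] at h1
  have h2 := conj_apply_self (hρ.mapUnit g)⁻¹ (ρ (e K y)) x
  rw [inv_inv, ← h1, e_apply_self] at h2
  exact h2.symm

/-- `ρ` sends a nonzero element of `e_x FI e_y` into `ρ(e_y) FI ρ(e_x)`, and the conjugations carry
this to the corner `e_{y'} FI e_{x'}`. -/
theorem le_of_map_e_apply_self (hρ : IsAlgInvolution ρ) {x y x' y' : X}
    (hx : ρ (e K x) x' x' = 1) (hy : ρ (e K y) y' y' = 1) (hxy : x ≤ y) : y' ≤ x' := by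
  obtain ⟨f, hf⟩ := (le_iff_exists_e_mul_mul_e_ne_zero (K := K) x y).1 hxy
  obtain ⟨g, hg⟩ := map_e_conj hρ hx
  obtain ⟨k, hk⟩ := map_e_conj hρ hy
  refine (le_iff_exists_e_mul_mul_e_ne_zero (K := K) y' x').2
    ⟨(k⁻¹ : (FI X K)ˣ) * ρ f * g, fun h0 => hf ?_⟩
  have h1 : ρ (e K x * f * e K y) = k * (e K y' * ((k⁻¹ : (FI X K)ˣ) * ρ f * g) * e K x') *
      (g⁻¹ : (FI X K)ˣ) := by
    rw [hρ.map_mul_rev, hρ.map_mul_rev, hg, hk]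
    simp only [mul_assoc]
  rw [h0, mul_zero, zero_mul] at h1
  rw [← hρ.involutive (e K x * f * e K y), h1, hρ.map_zero]

/-- Every involution on `FI(X, K)` induces an involution on `X`. -/
theorem exists_isPosetInvolution (hρ : IsAlgInvolution ρ) :
    ∃ l : X → X, IsPosetInvolution l ∧ ∀ x y, ρ (e K x) y y = 1 ↔ y = l x := by
  choose l hl using exists_map_e_apply_self hρ
  have hinv : ∀ x, l (l x) = x := fun x =>
    eq_of_map_e_apply_self hρ (map_e_apply_self_symm hρ (hl x)) (hl (l x))
  refine ⟨l, ⟨hinv, fun x y => ⟨le_of_map_e_apply_self hρ (hl x) (hl y), fun h => ?_⟩⟩,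
    fun x y => ⟨eq_of_map_e_apply_self hρ (hl x), fun h => h ▸ hl x⟩⟩
  exact le_of_map_e_apply_self hρ (map_e_apply_self_symm hρ (hl y))
    (map_e_apply_self_symm hρ (hl x)) h

end Involution

end FI

/-! ### Comparison of two involutions intertwined by `Ψ_u`. -/

theorem theorem4p3 {X K : Type*} [PartialOrder X] [Field K]
    (hK : ringChar K ≠ 2) (hX : PosetConnected X) (hM : FI.MultAutsInner X K)
    (ρ₁ ρ₂ : FI X K → FI X K) (hρ₁ : IsAlgInvolution ρ₁) (hρ₂ : IsAlgInvolution ρ₂)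
    (u : (FI X K)ˣ) (hu : ⇑(innerAut K u) ∘ ρ₂ = ρ₁ ∘ ⇑(innerAut K u)) :
    (∃ l : X → X, IsPosetInvolution l ∧ FI.Induces ρ₁ l ∧ FI.Induces ρ₂ l) ∧
      ∀ k : K, ρ₁ (algebraMap K (FI X K) k) = ρ₂ (algebraMap K (FI X K) k) := by
  have hu' : ∀ a, u * ρ₂ a * (u⁻¹ : (FI X K)ˣ) = ρ₁ (u * a * (u⁻¹ : (FI X K)ˣ)) :=
    fun a => congrFun hu a
  constructor
  · obtain ⟨l, hl, hl'⟩ := FI.exists_isPosetInvolution hρ₁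
    refine ⟨l, hl, fun x y => (FI.map_e_conj_iff hρ₁ x y).trans (hl' x y), fun x y =>
      (FI.map_e_conj_iff hρ₂ x y).trans (Iff.trans ?_ (hl' x y))⟩
    -- `ρ₁(u e_x u⁻¹)` is a conjugate both of `ρ₁(e_x)` and, by the intertwining relation, of
    -- `ρ₂(e_x)`.
    have h1 := FI.conj_apply_self (hρ₁.mapUnit u)⁻¹ (ρ₁ (FI.e K x)) y
    rw [inv_inv, ← hρ₁.map_conj, ← hu', FI.conj_apply_self] at h1
    rw [h1]
  · intro k
    have h := hu' (algebraMap K (FI X K) k)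
    have hc := hρ₂.commute_map (Algebra.commutes k) (u : FI X K)
    rw [← hc.eq, mul_assoc, Units.mul_inv, mul_one, ← Algebra.commutes k (u : FI X K), mul_assoc,
      Units.mul_inv, mul_one] at h
    exact h.symm
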